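/- Identify $\mathbb{R}^2$ with $\mathbb{C}$, so that $iq$ is the counterclockwise rotation of $q\in\mathbb{R}^2$ by $\pi/2$. Let $W^{1,1}$ denote the space of mappings $u\in W^{1,1}_{loc}(\mathbb{R};\mathbb{R}^2)$ such that $u(t+1)=u(t)$ for all $t\in\mathbb{R}$, and let $\dot u$ denote the weak derivative of $u$. Let $F:\mathbb{R}^2\times\mathbb{R}^2\to\mathbb{R}$ be a continuous function such that 1. $F(p,\theta q_1+(1-\theta)q_2)\le\theta F(p,q_1)+(1-\theta)F(p,q_2)$ for all $p,q_1,q_2\in\mathbb{R}^2$ and $\theta\in[0,1]$; 2. $F(p,\lambda q)=\lambda F(p,q)$ for all $p,q\in\mathbb{R}^2$ and $\lambda>0$; 3. there are constants $m_1,m_2>0$ such that $m_1|q|\le F(p,q)\le m_2|q|$ for all $p,q\in\mathbb{R}^2$; 4. $F(p+n,q)=F(p,q)$ for all $p,q\in\mathbb{R}^2$ and $n\in\mathbb{Z}^2$. For $u\in W^{1,1}$ set $$\mathcal{F}(u)=\int_0^1F(u,\dot u)\,dt,\qquad \mathcal{A}(u)=\frac12\int_0^1u\cdot i\dot u\,dt$$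 (the signed area, with the sign for which clockwise simple loops have positive area), and for $\tau\in\mathbb{R}$ let $$\mathcal{M}_\tau=\{u\in W^{1,1}:\mathcal{A}(u)=\tau\},\qquad S_F(\tau)=\inf_{v\in\mathcal{M}_\tau}\mathcal{F}(v).$$ Then for every $\tau\in\mathbb{R}$ there exists a Lipschitz continuous $u_\tau\in\mathcal{M}_\tau$ such that $\mathcal{F}(u_\tau)=S_F(\tau)$, that is, $u_\tau$ minimizes $\mathcal{F}$ on $\mathcal{M}_\tau$. -/

import Mathlib

open MeasureTheory Set
open scoped ContDiff

/-- The Euclidean plane `ℝ²`. -/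
abbrev Plane : Type := EuclideanSpace ℝ (Fin 2)

/-- Multiplication by `i`: the counterclockwise rotation by `π / 2` of the plane. -/
def rotI (q : Plane) : Plane := !₂[-(q 1), q 0]

/-- `v ∈ L¹_loc(ℝ; ℝ²)` is a weak derivative of `u : ℝ → ℝ²`. -/
def IsWeakDeriv (u v : ℝ → Plane) : Prop :=
  LocallyIntegrable v ∧
    ∀ φ : ℝ → ℝ, ContDiff ℝ ∞ φ → HasCompactSupport φ →
      ∫ t, deriv φ t • u t = -∫ t, φ t • v t

/-- Weak derivatives are unique up to null sets. -/
theorem IsWeakDeriv.ae_eq {u v w : ℝ → Plane} (hv : IsWeakDeriv u v) (hw : IsWeakDeriv u w) :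
    v =ᵐ[volume] w := by
  have key : ∀ᵐ t ∂(volume : Measure ℝ), (v - w) t = 0 := by
    refine ae_eq_zero_of_integral_contDiff_smul_eq_zero (hv.1.sub hw.1) ?_
    intro φ hφ hc
    have h1 := hv.2 φ hφ hc
    have h2 := hw.2 φ hφ hc
    have i1 : Integrable (fun t => φ t • v t) volume :=
      hv.1.integrable_smul_left_of_hasCompactSupport hφ.continuous hc
    have i2 : Integrable (fun t => φ t • w t) volume :=
      hw.1.integrable_smul_left_of_hasCompactSupport hφ.continuous hc
    have h3 : ∫ t, φ t • v t = ∫ t, φ t • w t := neg_injective (h1.symm.trans h2)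
    simp only [Pi.sub_apply, smul_sub]
    rw [integral_sub i1 i2, h3, sub_self]
  filter_upwards [key] with t ht
  exact sub_eq_zero.mp ht

/-- The space `W^{1,1}_loc(ℝ; ℝ²)`. -/
def MemW11Loc (u : ℝ → Plane) : Prop :=
  LocallyIntegrable u ∧ ∃ v, IsWeakDeriv u v

/-- The space `W^{1,1} = W^{1,1}(ℝ / ℤ; ℝ²)` of `1`-periodic mappings in `W^{1,1}_loc`. -/
def W11Loops : Set (ℝ → Plane) :=
  {u | MemW11Loc u ∧ Function.Periodic u 1}

open Classical in
/-- The weak derivative `u̇` of `u` (a representative; the value `0` is used if there is none). -/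
noncomputable def weakDeriv (u : ℝ → Plane) : ℝ → Plane :=
  if h : ∃ v, IsWeakDeriv u v then h.choose else 0

theorem MemW11Loc.isWeakDeriv_weakDeriv {u : ℝ → Plane} (hu : MemW11Loc u) :
    IsWeakDeriv u (weakDeriv u) := by
  rw [weakDeriv, dif_pos hu.2]
  exact hu.2.choose_spec

/-- The variational integral `𝓕(u) = ∫₀¹ F(u, u̇) dt`. -/
noncomputable def genLength (F : Plane → Plane → ℝ) (u : ℝ → Plane) : ℝ :=
  ∫ t in (0 : ℝ)..1, F (u t) (weakDeriv u t)

/-- The signed area `𝓐(u) = ½ ∫₀¹ u · i u̇ dt`. -/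
noncomputable def signedArea (u : ℝ → Plane) : ℝ :=
  (1 / 2) * ∫ t in (0 : ℝ)..1, inner ℝ (u t) (rotI (weakDeriv u t))

/-- The constraint `𝓜_τ = {u ∈ W^{1,1} | 𝓐(u) = τ}`. -/
def areaClass (τ : ℝ) : Set (ℝ → Plane) :=
  {u | u ∈ W11Loops ∧ signedArea u = τ}

/-- `S_F(τ) = inf_{v ∈ 𝓜_τ} 𝓕(v)`. -/
noncomputable def isoInf (F : Plane → Plane → ℝ) (τ : ℝ) : ℝ :=
  sInf (genLength F '' areaClass τ)

open Filter Topology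

/-! The proof is the direct method. Since `F` has only linear growth, a bound on `genLength` gives
no weak compactness in W^{1,1}. But both integrands are positively homogeneous of degree one in the
velocity, so both functionals are invariant under reparametrisation, and ellipticity bounds
Euclidean length by `genLength F u / m₁`. Hence a minimising sequence may be reparametrised with
uniformly bounded speed (`exists_lipschitzWith_reparam`) and translated by integer vectors to start
near the origin (`exists_lipschitzWith_loop`), keeping length and area.

Arzelà–Ascoli (`exists_subseq_tendstoUniformly`) then gives a uniform limit, which is automatically
Lipschitz. The area passes to the limit because its polarisation is symmetric
(`tendsto_integral_inner_rotI`), and the length is lower semicontinuous by convexity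
(`integral_le_of_tendstoUniformly`). The latter needs no weak convergence of derivatives: Jensen's
inequality compares the integral with one of difference quotients, which do converge uniformly at a
fixed step. -/

theorem MeasureTheory.LocallyIntegrable.intervalIntegrable' {E : Type*} [NormedAddCommGroup E]
    {v : ℝ → E} (hv : LocallyIntegrable v) (a b : ℝ) : IntervalIntegrable v volume a b :=
  intervalIntegrable_iff.mpr
    ((hv.integrableOn_isCompact isCompact_uIcc).mono_set uIoc_subset_uIcc)

/-! ### Absolutely continuous curves as indefinite integrals -/

section Primitive

variable {E G : Type*} [NormedAddCommGroup E] [NormedSpace ℝ E] [NormedAddCommGroup G]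
  [NormedSpace ℝ G]

/-- `u` is an indefinite integral of the locally integrable function `v`. -/
structure IsPrimitive (u v : ℝ → E) : Prop where
  locallyIntegrable : LocallyIntegrable v
  integral_eq : ∀ a b, ∫ t in a..b, v t = u b - u a

theorem isPrimitive_integral {v : ℝ → E} (hv : LocallyIntegrable v) (a : ℝ) (c : E) :
    IsPrimitive (fun t => c + ∫ x in a..t, v x) v := by
  refine ⟨hv, fun x y => ?_⟩
  rw [add_sub_add_left_eq_sub, intervalIntegral.integral_interval_sub_left
    (hv.intervalIntegrable' _ _) (hv.intervalIntegrable' _ _)]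

namespace IsPrimitive

variable {u v : ℝ → E}

theorem intervalIntegrable (h : IsPrimitive u v) (a b : ℝ) : IntervalIntegrable v volume a b :=
  h.locallyIntegrable.intervalIntegrable' a b

theorem eq_integral (h : IsPrimitive u v) (a : ℝ) : u = fun t => u a + ∫ x in a..t, v x := by
  ext t
  rw [h.integral_eq]
  abel

protected theorem continuous (h : IsPrimitive u v) : Continuous u := by
  rw [h.eq_integral 0]
  exact continuous_const.add (intervalIntegral.continuous_primitive h.intervalIntegrable 0)

theorem ae_hasDerivAt [CompleteSpace E] (h : IsPrimitive u v) : ∀ᵐ t, HasDerivAt u (v t) t := by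
  filter_upwards [_root_.LocallyIntegrable.ae_hasDerivAt_integral h.locallyIntegrable] with t ht
  rw [h.eq_integral 0]
  exact (ht 0).const_add _

theorem deriv_ae_eq [CompleteSpace E] (h : IsPrimitive u v) : deriv u =ᵐ[volume] v := by
  filter_upwards [h.ae_hasDerivAt] with t ht using ht.deriv

theorem congr_ae {v' : ℝ → E} (h : IsPrimitive u v) (hv : v =ᵐ[volume] v') : IsPrimitive u v' := by
  refine ⟨h.locallyIntegrable.congr hv, fun a b => ?_⟩
  rw [← h.integral_eq]
  exact intervalIntegral.integral_congr_ae (by filter_upwards [hv] with t ht _ using ht.symm)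

theorem clm_comp [CompleteSpace E] [CompleteSpace G] (h : IsPrimitive u v) (L : E →L[ℝ] G) :
    IsPrimitive (fun t => L (u t)) (fun t => L (v t)) := by
  refine ⟨fun x => ?_, fun a b => ?_⟩
  · obtain ⟨s, hs, hi⟩ := h.locallyIntegrable x
    exact ⟨s, hs, L.integrable_comp hi⟩
  · rw [L.intervalIntegral_comp_comm (h.intervalIntegrable a b), h.integral_eq, map_sub]

theorem absolutelyContinuousOnInterval {f g : ℝ → ℝ} (h : IsPrimitive f g) (a b : ℝ) :
    AbsolutelyContinuousOnInterval f a b := by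
  have h1 := (h.intervalIntegrable a b).absolutelyContinuousOnInterval_intervalIntegral
    (c := a) (by simp)
  have h2 : AbsolutelyContinuousOnInterval (fun _ : ℝ => f a) a b :=
    ((LipschitzWith.const (f a)).lipschitzOnWith (s := uIcc a b)).absolutelyContinuousOnInterval
  rw [h.eq_integral a]
  exact h2.add h1

/-- The fundamental theorem of calculus for absolutely continuous functions; through it, products
and Lipschitz maps become primitives. -/
theorem of_absolutelyContinuous {f g : ℝ → ℝ} (hf : ∀ a b, AbsolutelyContinuousOnInterval f a b)
    (hg : LocallyIntegrable g) (hd : ∀ᵐ t, HasDerivAt f (g t) t) : IsPrimitive f g := by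
  refine ⟨hg, fun a b => ?_⟩
  rw [← (hf a b).integral_deriv_eq_sub]
  exact intervalIntegral.integral_congr_ae (by filter_upwards [hd] with t ht _ using ht.deriv.symm)

theorem mul {f f' g g' : ℝ → ℝ} (hf : IsPrimitive f f') (hg : IsPrimitive g g') :
    IsPrimitive (fun t => f t * g t) (fun t => f' t * g t + f t * g' t) := by
  refine of_absolutelyContinuous (fun a b => (hf.absolutelyContinuousOnInterval a b).mul
    (hg.absolutelyContinuousOnInterval a b)) ?_ ?_
  · refine LocallyIntegrable.add ?_ ?_
    · simpa only [smul_eq_mul, mul_comm] using hf.locallyIntegrable.smul_continuous hg.continuous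
    · exact hg.locallyIntegrable.continuous_smul hf.continuous
  · filter_upwards [hf.ae_hasDerivAt, hg.ae_hasDerivAt] with t h1 h2 using h1.mul h2

end IsPrimitive

theorem isPrimitive_of_contDiff {u : ℝ → E} [CompleteSpace E] (h : ContDiff ℝ 1 u) :
    IsPrimitive u (deriv u) := by
  have hc : Continuous (deriv u) := h.continuous_deriv le_rfl
  refine ⟨hc.locallyIntegrable, fun a b => ?_⟩
  exact intervalIntegral.integral_deriv_eq_sub
    (fun x _ => (h.differentiable one_ne_zero).differentiableAt) (hc.intervalIntegrable a b)

end Primitive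

theorem plane_proj_integral {f : ℝ → Plane} (hf : Integrable f) (i : Fin 2) :
    (∫ t, f t) i = ∫ t, f t i := by
  have := (EuclideanSpace.proj (𝕜 := ℝ) i : Plane →L[ℝ] ℝ).integral_comp_comm hf
  simpa using this.symm

theorem IsPrimitive.plane_proj {u v : ℝ → Plane} (h : IsPrimitive u v) (i : Fin 2) :
    IsPrimitive (fun t => u t i) (fun t => v t i) := by
  simpa using h.clm_comp (EuclideanSpace.proj (𝕜 := ℝ) i : Plane →L[ℝ] ℝ)

theorem isPrimitive_plane {u v : ℝ → Plane}
    (h : ∀ i, IsPrimitive (fun t => u t i) (fun t => v t i)) : IsPrimitive u v := by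
  have hv : LocallyIntegrable v := by
    intro x
    have h0 := fun i => (h i).locallyIntegrable x
    choose s hs hi using h0
    refine ⟨⋂ i, s i, (iInter_mem.mpr hs), ?_⟩
    refine Integrable.of_eval_piLp fun i => ?_
    exact (hi i).mono_set (iInter_subset s i)
  refine ⟨hv, fun a b => ?_⟩
  ext i
  have h1 := (EuclideanSpace.proj (𝕜 := ℝ) i : Plane →L[ℝ] ℝ).intervalIntegral_comp_comm
    (hv.intervalIntegrable' a b)
  have h2 := (h i).integral_eq a b
  simp only [PiLp.proj_apply] at h1
  rw [PiLp.sub_apply, ← h2, h1]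

/-! ### Weak derivatives and absolutely continuous representatives -/

theorem integral_deriv_mul_of_hasCompactSupport {f g φ : ℝ → ℝ} (h : IsPrimitive f g)
    (hφ : ContDiff ℝ ∞ φ) (hc : HasCompactSupport φ) :
    ∫ t, deriv φ t * f t = -∫ t, φ t * g t := by
  have hp := (isPrimitive_of_contDiff (hφ.of_le (by exact_mod_cast le_top))).mul h
  have hc' := hc.deriv
  have i1 : Integrable fun t => deriv φ t * f t := by
    refine Continuous.integrable_of_hasCompactSupport ?_ hc'.mul_right
    exact (hφ.continuous_deriv (by exact_mod_cast le_top)).mul h.continuous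
  have i2 : Integrable fun t => φ t * g t :=
    h.locallyIntegrable.integrable_smul_left_of_hasCompactSupport hφ.continuous hc
  rw [eq_neg_iff_add_eq_zero, ← integral_add i1 i2]
  obtain ⟨R, hR⟩ := hc.isCompact.isBounded.subset_ball_lt 0 0
  have hs : ∀ t, t ∉ Ioo (-R) R → φ t = 0 := by
    intro t ht
    refine image_eq_zero_of_notMem_tsupport fun h => ht ?_
    have := hR.2 h
    rw [Real.ball_eq_Ioo] at this
    simpa using this
  have hs' : ∀ t, t ∉ Ioo (-R) R → deriv φ t = 0 := by
    intro t ht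
    refine image_eq_zero_of_notMem_tsupport fun h => ht ?_
    have := hR.2 (closure_minimal (support_deriv_subset) isClosed_closure h)
    rw [Real.ball_eq_Ioo] at this
    simpa using this
  -- The integrand is the derivative of `φ * f`, which vanishes at both `-R` and `R`.
  rw [← intervalIntegral.integral_eq_integral_of_support_subset (a := -R) (b := R), hp.integral_eq,
    hs R (by simp), hs (-R) (by simp)]
  · simp
  · intro t ht
    by_contra hn
    have : t ∉ Ioo (-R) R := fun h => hn (Ioo_subset_Ioc_self h)
    simp [hs t this, hs' t this] at ht

theorem IsPrimitive.isWeakDeriv {u v : ℝ → Plane} (h : IsPrimitive u v) : IsWeakDeriv u v := by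
  refine ⟨h.locallyIntegrable, fun φ hφ hc => ?_⟩
  have i1 : Integrable fun t => deriv φ t • u t :=
    h.continuous.locallyIntegrable.integrable_smul_left_of_hasCompactSupport
      (hφ.continuous_deriv (by exact_mod_cast le_top)) hc.deriv
  have i2 : Integrable fun t => φ t • v t :=
    h.locallyIntegrable.integrable_smul_left_of_hasCompactSupport hφ.continuous hc
  ext i
  rw [PiLp.neg_apply, plane_proj_integral i1, plane_proj_integral i2]
  simpa using integral_deriv_mul_of_hasCompactSupport (h.plane_proj i) hφ hc

/-- A compactly supported smooth function with vanishing integral has a compactly supported smooth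
antiderivative. -/
theorem exists_contDiff_hasCompactSupport_deriv_eq {ψ : ℝ → ℝ} (hψ : ContDiff ℝ ∞ ψ)
    (hc : HasCompactSupport ψ) (h0 : ∫ t, ψ t = 0) :
    ∃ φ : ℝ → ℝ, ContDiff ℝ ∞ φ ∧ HasCompactSupport φ ∧ deriv φ = ψ := by
  obtain ⟨R, hR0, hR⟩ := hc.isCompact.isBounded.subset_ball_lt 0 0
  have hs : ∀ t, t ∉ Ioo (-R) R → ψ t = 0 := by
    intro t ht
    refine image_eq_zero_of_notMem_tsupport fun h => ht ?_
    have := hR h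
    rw [Real.ball_eq_Ioo] at this
    simpa using this
  have hd : ∀ t, HasDerivAt (fun t => ∫ x in (-R)..t, ψ x) (ψ t) t := fun t =>
    hψ.continuous.integral_hasStrictDerivAt (-R) t |>.hasDerivAt
  have hd' : deriv (fun t => ∫ x in (-R)..t, ψ x) = ψ := funext fun t => (hd t).deriv
  refine ⟨fun t => ∫ x in (-R)..t, ψ x, ?_, ?_, hd'⟩
  · rw [contDiff_infty_iff_deriv]
    exact ⟨fun t => (hd t).differentiableAt, hd'.symm ▸ hψ⟩
  · refine HasCompactSupport.intro (isCompact_Icc (a := -R) (b := R)) fun t ht => ?_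
    rcases lt_or_ge t (-R) with h | h
    · refine intervalIntegral.integral_zero_ae (Eventually.of_forall fun x hx => hs x ?_)
      rw [uIoc_of_ge h.le] at hx
      exact fun h' => absurd h'.1 (not_lt.mpr hx.2)
    · have h : R < t := by
        by_contra h'
        exact ht ⟨h, not_lt.mp h'⟩
      rw [intervalIntegral.integral_eq_integral_of_support_subset, h0]
      intro x hx
      by_contra hn
      refine hx (hs x fun h' => hn ⟨h'.1, (h'.2.trans h).le⟩)

/-- **Du Bois-Reymond lemma**: a function with vanishing weak derivative is constant. -/
theorem ae_eq_const_of_isWeakDeriv_zero {u : ℝ → Plane} (hu : LocallyIntegrable u)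
    (h : IsWeakDeriv u 0) : ∃ c, u =ᵐ[volume] fun _ => c := by
  obtain ⟨η⟩ : Nonempty (ContDiffBump (0 : ℝ)) := inferInstance
  set k := η.normed volume with hk
  have hk1 : ContDiff ℝ ∞ k := η.contDiff_normed
  have hk2 : HasCompactSupport k := η.hasCompactSupport_normed
  have hk3 : ∫ t, k t = 1 := η.integral_normed
  refine ⟨∫ t, k t • u t, ?_⟩
  set c := ∫ t, k t • u t with hcdef
  have key : ∀ᵐ t, u t - c = 0 := by
    refine ae_eq_zero_of_integral_contDiff_smul_eq_zero
      (hu.sub (locallyIntegrable_const c)) fun ψ hψ hψc => ?_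
    have j1 : Integrable ψ := hψ.continuous.integrable_of_hasCompactSupport hψc
    have j2 : Integrable k := hk1.continuous.integrable_of_hasCompactSupport hk2
    have i1 : Integrable fun t => ψ t • u t :=
      hu.integrable_smul_left_of_hasCompactSupport hψ.continuous hψc
    have i2 : Integrable fun t => k t • u t :=
      hu.integrable_smul_left_of_hasCompactSupport hk1.continuous hk2
    -- Subtracting the mass of `ψ` times the unit-mass bump `k` leaves mean zero, hence the
    -- derivative of a test function.
    obtain ⟨φ, hφ, hφc, hφd⟩ := exists_contDiff_hasCompactSupport_deriv_eq
      (ψ := fun t => ψ t - (∫ x, ψ x) * k t) (hψ.sub (contDiff_const.mul hk1))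
      (hψc.sub hk2.mul_left) (by
        rw [integral_sub j1 (j2.const_mul _), integral_const_mul, hk3, mul_one, sub_self])
    have h1 := h.2 φ hφ hφc
    simp only [hφd, sub_smul, mul_smul, Pi.zero_apply, smul_zero, integral_zero, neg_zero] at h1
    rw [integral_sub i1 (g := fun t => (∫ x, ψ x) • k t • u t) (i2.smul (∫ x, ψ x)), integral_smul,
      ← hcdef] at h1
    simp only [smul_sub]
    rw [integral_sub i1 (j1.smul_const c), integral_smul_const, h1]
  filter_upwards [key] with t ht using sub_eq_zero.mp ht

/-- The absolutely continuous representative of a function with a weak derivative. -/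
theorem exists_isPrimitive_of_isWeakDeriv {u v : ℝ → Plane} (hu : LocallyIntegrable u)
    (h : IsWeakDeriv u v) : ∃ U, u =ᵐ[volume] U ∧ IsPrimitive U v := by
  have hp := isPrimitive_integral h.1 0 (0 : Plane)
  have hd : IsWeakDeriv (fun t => u t - (0 + ∫ x in (0 : ℝ)..t, v x)) 0 := by
    refine ⟨locallyIntegrable_const (0 : Plane), fun φ hφ hc => ?_⟩
    have hφ' := (hφ.continuous_deriv (by exact_mod_cast le_top))
    simp only [smul_sub]
    rw [integral_sub (hu.integrable_smul_left_of_hasCompactSupport hφ' hc.deriv)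
      (hp.continuous.locallyIntegrable.integrable_smul_left_of_hasCompactSupport hφ' hc.deriv),
      h.2 φ hφ hc, hp.isWeakDeriv.2 φ hφ hc]
    simp
  obtain ⟨c, hc⟩ := ae_eq_const_of_isWeakDeriv_zero (hu.sub hp.continuous.locallyIntegrable) hd
  refine ⟨fun t => c + ∫ x in (0 : ℝ)..t, v x, ?_, isPrimitive_integral h.1 0 c⟩
  filter_upwards [hc] with t ht
  rw [← ht]
  simp

theorem Function.Periodic.deriv {E : Type*} [NormedAddCommGroup E] [NormedSpace ℝ E] {u : ℝ → E}
    {c : ℝ} (h : Function.Periodic u c) : Function.Periodic (deriv u) c := by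
  intro t
  rw [← deriv_comp_add_const]
  congr 1
  exact funext h

/-- A loop in `W^{1,1}` has an absolutely continuous periodic representative. -/
theorem exists_periodic_isPrimitive {u : ℝ → Plane} (hu : u ∈ W11Loops) :
    ∃ U, u =ᵐ[volume] U ∧ IsPrimitive U (deriv U) ∧ Function.Periodic U 1 ∧
      weakDeriv u =ᵐ[volume] deriv U := by
  obtain ⟨U, hU, hp⟩ := exists_isPrimitive_of_isWeakDeriv hu.1.1 hu.1.isWeakDeriv_weakDeriv
  have hd := hp.deriv_ae_eq
  refine ⟨U, hU, hp.congr_ae hd.symm, ?_, hd.symm⟩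
  have h1 : (fun t => U (t + 1)) =ᵐ[volume] U := by
    have h2 := (measurePreserving_add_right (volume : Measure ℝ) 1).quasiMeasurePreserving.ae_eq_comp
      hU
    filter_upwards [hU, h2] with t h3 h4
    rw [← h3, ← hu.2 t]
    exact h4.symm
  -- Continuity upgrades periodicity almost everywhere to periodicity everywhere.
  have h5 := (Continuous.ae_eq_iff_eq volume (hp.continuous.comp (continuous_add_const 1))
    hp.continuous).mp h1
  exact fun t => congrFun h5 t

theorem IsPrimitive.weakDeriv_ae_eq {u v : ℝ → Plane} (h : IsPrimitive u v) :
    weakDeriv u =ᵐ[volume] v :=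
  IsWeakDeriv.ae_eq (MemW11Loc.isWeakDeriv_weakDeriv ⟨h.continuous.locallyIntegrable, v, h.isWeakDeriv⟩)
    h.isWeakDeriv

theorem IsPrimitive.mem_W11Loops {u v : ℝ → Plane} (h : IsPrimitive u v)
    (hu : Function.Periodic u 1) : u ∈ W11Loops :=
  ⟨⟨h.continuous.locallyIntegrable, v, h.isWeakDeriv⟩, hu⟩

/-! ### Lipschitz curves and reparametrisation -/

theorem LipschitzWith.isPrimitive {u : ℝ → Plane} {K : NNReal} (h : LipschitzWith K u) :
    IsPrimitive u (deriv u) := by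
  refine isPrimitive_plane fun i => ?_
  have hb : ∀ t, ‖deriv u t‖ ≤ K := fun t => norm_deriv_le_of_lipschitz h
  refine IsPrimitive.of_absolutelyContinuous (fun a b => ?_) ?_ ?_
  · have h0 : LipschitzWith 1 fun p : Plane => p i := LipschitzWith.of_dist_le_mul fun x y => by
      simpa [dist_eq_norm] using PiLp.norm_apply_le (x - y) i
    have h1 : LipschitzWith (1 * K) fun t => u t i := h0.comp h
    exact (h1.lipschitzOnWith).absolutelyContinuousOnInterval
  · refine (locallyIntegrable_const (K : ℝ)).mono ?_ ?_
    · exact (((EuclideanSpace.proj (𝕜 := ℝ) i : Plane →L[ℝ] ℝ).measurable.comp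
        (measurable_deriv u))).aestronglyMeasurable
    · refine Eventually.of_forall fun t => ?_
      simpa using (PiLp.norm_apply_le (deriv u t) i).trans (hb t)
  · filter_upwards [h.ae_differentiableAt_real] with t ht
    exact ((EuclideanSpace.proj (𝕜 := ℝ) i : Plane →L[ℝ] ℝ).hasFDerivAt.comp_hasDerivAt t
      ht.hasDerivAt)

/-- The normalised arclength parametrisation (with a unit added to the speed, to make it strictly
increasing) turns an absolutely continuous loop into a Lipschitz one, without changing any
parametrisation-invariant integral. -/
theorem exists_lipschitzWith_reparam {u v : ℝ → Plane} (h : IsPrimitive u v)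
    (hu : Function.Periodic u 1) (hv : Function.Periodic v 1) :
    ∃ w, LipschitzWith ((∫ t in (0 : ℝ)..1, ‖v t‖) + 1).toNNReal w ∧ Function.Periodic w 1 ∧
      ∀ Φ : Plane → Plane → ℝ, (∀ (p q : Plane) (l : ℝ), 0 < l → Φ p (l • q) = l * Φ p q) →
        ∫ t in (0 : ℝ)..1, Φ (w t) (deriv w t) = ∫ t in (0 : ℝ)..1, Φ (u t) (v t) := by
  set M := (∫ t in (0 : ℝ)..1, ‖v t‖) + 1 with hM
  have hM0 : 0 < M := by
    have : 0 ≤ ∫ t in (0 : ℝ)..1, ‖v t‖ :=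
      intervalIntegral.integral_nonneg zero_le_one fun t _ => norm_nonneg _
    linarith
  set σ : ℝ → ℝ := fun t => M⁻¹ * (‖v t‖ + 1) with hσ
  have hσpos : ∀ t, 0 < σ t := fun t => by positivity
  have hnl : LocallyIntegrable fun t => ‖v t‖ := fun x => by
    obtain ⟨A, hA, hi⟩ := h.locallyIntegrable x
    exact ⟨A, hA, hi.norm⟩
  have hσloc : LocallyIntegrable σ := by
    have h1 : LocallyIntegrable fun t => ‖v t‖ + 1 :=
      LocallyIntegrable.add hnl (locallyIntegrable_const (1 : ℝ))
    exact h1.smul M⁻¹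
  have hnloc : ∀ a b, IntervalIntegrable (fun t => ‖v t‖) volume a b :=
    hnl.intervalIntegrable'
  set s : ℝ → ℝ := fun t => 0 + ∫ x in (0 : ℝ)..t, σ x with hsdef
  have hs : IsPrimitive s σ := isPrimitive_integral hσloc 0 0
  have hσper : Function.Periodic σ 1 := fun t => by simp only [hσ, hv t]
  have hσ1 : ∫ t in (0 : ℝ)..1, σ t = 1 := by
    simp only [hσ]
    rw [intervalIntegral.integral_const_mul,
      intervalIntegral.integral_add (hnloc 0 1) (by simp)]
    simp only [intervalIntegral.integral_const, sub_zero, smul_eq_mul, mul_one]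
    exact inv_mul_cancel₀ hM0.ne'
  have hsadd : ∀ t, s (t + 1) = s t + 1 := fun t => by
    have h1 := hσper.intervalIntegral_add_eq t 0
    rw [hs.integral_eq, zero_add, hσ1] at h1
    linarith
  have hs0 : s 0 = 0 := by simp [hsdef]
  have hs1 : s 1 = 1 := by simpa [hs0] using hsadd 0
  -- The added unit makes `s` grow at rate at least `M⁻¹` even where `u` rests; so `s` is injective
  -- and onto.
  have hlow : ∀ a b, a ≤ b → M⁻¹ * (b - a) ≤ s b - s a := fun a b hab => by
    rw [← hs.integral_eq]
    have h1 : ∫ _ in a..b, M⁻¹ = M⁻¹ * (b - a) := by simp [mul_comm]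
    rw [← h1]
    refine intervalIntegral.integral_mono_on hab (by simp) (hs.intervalIntegrable a b) fun t _ => ?_
    have := norm_nonneg (v t)
    have h2 : 0 ≤ M⁻¹ * ‖v t‖ := by positivity
    simp only [hσ]
    linarith
  have hmono : StrictMono s := fun a b hab => by
    have h1 := hlow a b hab.le
    have h2 : 0 < M⁻¹ * (b - a) := mul_pos (inv_pos.mpr hM0) (sub_pos.mpr hab)
    linarith
  have hsurj : Function.Surjective s := by
    refine hs.continuous.surjective ?_ ?_
    · refine tendsto_atTop_mono' _ ?_ (tendsto_id.const_mul_atTop (inv_pos.mpr hM0))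
      filter_upwards [eventually_ge_atTop 0] with t ht
      simpa [hs0] using hlow 0 t ht
    · refine tendsto_atBot_mono' _ ?_ (tendsto_id.const_mul_atBot (inv_pos.mpr hM0))
      filter_upwards [eventually_le_atBot 0] with t ht
      have := hlow t 0 ht
      simp only [hs0, id] at this ⊢
      linarith
  set e := StrictMono.orderIsoOfSurjective s hmono hsurj with he
  have hes : ∀ t, e t = s t := fun t => rfl
  have hTs : ∀ t, e.symm (s t) = t := fun t => e.symm_apply_apply t
  have hsT : ∀ x, s (e.symm x) = x := fun x => e.apply_symm_apply x
  have hTcont : Continuous e.symm := e.symm.continuous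
  -- As `‖v‖ ≤ M * σ`, this is the Lipschitz bound for `u` in the new parameter.
  have hup : ∀ a b, a ≤ b → ‖u b - u a‖ ≤ M * (s b - s a) := fun a b hab => by
    rw [← h.integral_eq, ← hs.integral_eq, ← intervalIntegral.integral_const_mul]
    refine (intervalIntegral.norm_integral_le_integral_norm hab).trans ?_
    refine intervalIntegral.integral_mono_on hab (hnloc a b)
      ((hs.intervalIntegrable a b).const_mul M) fun t _ => ?_
    simp only [hσ]
    rw [mul_inv_cancel_left₀ hM0.ne']
    linarith
  have hTadd : ∀ x, e.symm (x + 1) = e.symm x + 1 := fun x => by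
    apply hmono.injective
    rw [hsT, hsadd, hsT]
  refine ⟨fun x => u (e.symm x), ?_, fun x => ?_, fun Φ hΦ => ?_⟩
  · have hle : ∀ x y, x ≤ y → dist (u (e.symm x)) (u (e.symm y)) ≤ M * dist x y := fun x y hxy => by
      rw [dist_comm, dist_eq_norm, dist_comm, Real.dist_eq, abs_of_nonneg (sub_nonneg.mpr hxy)]
      simpa only [hsT] using hup _ _ (e.symm.monotone hxy)
    refine LipschitzWith.of_dist_le_mul fun x y => ?_
    rw [Real.coe_toNNReal _ hM0.le]
    rcases le_total x y with hxy | hxy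
    · exact hle x y hxy
    · rw [dist_comm, dist_comm x]
      exact hle y x hxy
  · simp only [hTadd, hu (e.symm x)]
  -- Change of variables on the set where `u` and `s` are both differentiable. Its image under `s`
  -- has measure `∫ σ = 1`, so it fills the unit interval up to a null set.
  · obtain ⟨G₀, hG₀, hG₀m, hG₀d⟩ := (h.ae_hasDerivAt.and hs.ae_hasDerivAt).exists_measurable_mem
    have hG : (G₀ ∩ Ioc 0 1 : Set ℝ) =ᵐ[volume] Ioc 0 1 := by
      filter_upwards [hG₀] with t ht
      exact propext ⟨fun h => h.2, fun h => ⟨ht, h⟩⟩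
    have hGm : MeasurableSet (G₀ ∩ Ioc 0 1) := hG₀m.inter measurableSet_Ioc
    have himm : MeasurableSet (s '' (G₀ ∩ Ioc 0 1)) :=
      hGm.image_of_monotoneOn (hmono.monotone.monotoneOn _)
    have hsub : s '' (G₀ ∩ Ioc 0 1) ⊆ Ioc 0 1 := by
      rintro _ ⟨t, ht, rfl⟩
      exact ⟨hs0 ▸ hmono ht.2.1, hs1 ▸ hmono.monotone ht.2.2⟩
    have hvol : volume (s '' (G₀ ∩ Ioc 0 1)) = 1 := by
      rw [← lintegral_deriv_eq_volume_image_of_monotoneOn hGm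
        (fun t ht => (hG₀d t ht.1).2.hasDerivWithinAt) (hmono.monotone.monotoneOn _),
        setLIntegral_congr hG, ← ofReal_integral_eq_lintegral_ofReal
          ((hs.intervalIntegrable 0 1).1) (Eventually.of_forall fun t => (hσpos t).le),
        ← intervalIntegral.integral_of_le zero_le_one, hσ1, ENNReal.ofReal_one]
    have him : (s '' (G₀ ∩ Ioc 0 1) : Set ℝ) =ᵐ[volume] Ioc 0 1 := by
      refine ae_eq_of_subset_of_measure_ge hsub ?_ himm.nullMeasurableSet (by simp)
      rw [hvol]
      simp
    rw [intervalIntegral.integral_of_le zero_le_one, intervalIntegral.integral_of_le zero_le_one,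
      ← setIntegral_congr_set him, ← setIntegral_congr_set hG,
      integral_image_eq_integral_abs_deriv_smul hGm
        (fun t ht => (hG₀d t ht.1).2.hasDerivWithinAt) hmono.injective.injOn]
    refine setIntegral_congr_fun hGm fun t ht => ?_
    obtain ⟨hd1, hd2⟩ := hG₀d t ht.1
    have hT' : HasDerivAt e.symm (σ t)⁻¹ (s t) := by
      refine HasDerivAt.of_local_left_inverse hTcont.continuousAt (f := s) ?_ (hσpos t).ne'
        (Eventually.of_forall hsT)
      rwa [hTs]
    have hw : HasDerivAt (fun x => u (e.symm x)) ((σ t)⁻¹ • v t) (s t) := by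
      refine HasDerivAt.scomp (s t) (g₁ := u) ?_ hT'
      rwa [hTs]
    simp only [hw.deriv, hTs, hΦ _ _ _ (inv_pos.mpr (hσpos t)), abs_of_pos (hσpos t), smul_eq_mul]
    exact mul_inv_cancel_left₀ (hσpos t).ne' _

/-! ### Lower semicontinuity via difference quotients -/

theorem intervalIntegrable_of_norm_le {E : Type*} [NormedAddCommGroup E] {f : ℝ → E}
    (hf : AEStronglyMeasurable f volume) {C : ℝ} (hC : ∀ t, ‖f t‖ ≤ C) (a b : ℝ) :
    IntervalIntegrable f volume a b :=
  (intervalIntegrable_const (c := C)).mono_fun hf.restrict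
    (Eventually.of_forall fun t => (hC t).trans (le_abs_self C))

theorem ConvexOn.map_interval_average_le {E : Type*} [NormedAddCommGroup E] [NormedSpace ℝ E]
    [CompleteSpace E] {g : E → ℝ} (hg : ConvexOn ℝ univ g) (hgc : Continuous g) {f : ℝ → E} {h : ℝ}
    (hh : 0 < h) (hf : IntervalIntegrable f volume 0 h)
    (hgf : IntervalIntegrable (fun s => g (f s)) volume 0 h) :
    g (h⁻¹ • ∫ s in (0 : ℝ)..h, f s) ≤ h⁻¹ * ∫ s in (0 : ℝ)..h, g (f s) := by
  have h1 := hg.map_set_average_le (μ := volume) (t := Ioc 0 h) hgc.continuousOn isClosed_univ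
    (by simpa using hh) (by simp) (by simp) hf.1 hgf.1
  rw [setAverage_eq, setAverage_eq, Real.volume_real_Ioc_of_le hh.le, sub_zero] at h1
  rwa [intervalIntegral.integral_of_le hh.le, intervalIntegral.integral_of_le hh.le]

/-- Averaging a periodic function over translations does not change its integral over a period. -/
theorem integral_average_translate_eq {G : ℝ → ℝ} {C h : ℝ} (hG : Function.Periodic G 1)
    (hm : Measurable G) (hC : ∀ t, ‖G t‖ ≤ C) (hh : 0 < h) :
    ∫ t in (0 : ℝ)..1, h⁻¹ * ∫ s in (0 : ℝ)..h, G (t + s) = ∫ t in (0 : ℝ)..1, G t := by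
  have h1 : ∀ s, ∫ t in (0 : ℝ)..1, G (t + s) = ∫ t in (0 : ℝ)..1, G t := fun s => by
    rw [intervalIntegral.integral_comp_add_right]
    have := hG.intervalIntegral_add_eq s 0
    simpa [add_comm] using this
  rw [intervalIntegral.integral_const_mul, intervalIntegral_intervalIntegral_swap]
  · simp only [h1, intervalIntegral.integral_const, sub_zero, smul_eq_mul]
    exact inv_mul_cancel_left₀ hh.ne' _
  · have hfin : volume (uIoc (0 : ℝ) 1 ×ˢ uIoc 0 h) < ⊤ := by
      rw [Measure.volume_eq_prod, Measure.prod_prod, uIoc_of_le zero_le_one, uIoc_of_le hh.le]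
      simp
    have : IsFiniteMeasure ((volume : Measure (ℝ × ℝ)).restrict (uIoc (0 : ℝ) 1 ×ˢ uIoc 0 h)) :=
      ⟨by simpa using hfin⟩
    exact Integrable.of_bound (hm.comp (measurable_fst.add measurable_snd)).aestronglyMeasurable C
      (Eventually.of_forall fun x => hC _)

section LowerSemicontinuity

variable {F : Plane → Plane → ℝ}

theorem measurable_integrand (hcont : Continuous fun x : Plane × Plane => F x.1 x.2)
    {u v : ℝ → Plane} (hu : Measurable u) (hv : Measurable v) :
    Measurable fun t => F (u t) (v t) :=
  hcont.measurable.comp (hu.prodMk hv)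

/-- Replacing the velocity by a difference quotient decreases the integral of a convex integrand,
up to the oscillation of the integrand in the position. -/
theorem integral_difference_quotient_le (hcont : Continuous fun x : Plane × Plane => F x.1 x.2)
    (hconv : ∀ p, ConvexOn ℝ univ (F p)) {m : ℝ} (hm : 0 ≤ m)
    (hF : ∀ p q : Plane, ‖F p q‖ ≤ m * ‖q‖) {K : NNReal} {w z : ℝ → Plane} (hw : Continuous w)
    (hz : LipschitzWith K z) (hzp : Function.Periodic z 1) {h ε : ℝ} (hh : 0 < h)
    (hε : ∀ t ∈ Icc (0 : ℝ) 1, ∀ s ∈ Icc 0 h, ∀ q : Plane, ‖q‖ ≤ K →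
      F (w t) q ≤ F (z (t + s)) q + ε) :
    ∫ t in (0 : ℝ)..1, F (w t) (h⁻¹ • (z (t + h) - z t)) ≤
      (∫ t in (0 : ℝ)..1, F (z t) (deriv z t)) + ε := by
  have hzd : ∀ t, ‖deriv z t‖ ≤ K := fun t => norm_deriv_le_of_lipschitz hz
  have hFz : ∀ p t, ‖F p (deriv z t)‖ ≤ m * K := fun p t =>
    (hF _ _).trans (mul_le_mul_of_nonneg_left (hzd t) hm)
  have hmeas : Measurable fun t => F (z t) (deriv z t) :=
    measurable_integrand hcont hz.continuous.measurable (measurable_deriv z)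
  have hGper : Function.Periodic (fun t => F (z t) (deriv z t)) 1 := fun t => by
    simp only [hzp t, hzp.deriv t]
  have hint : ∀ t a b, IntervalIntegrable (fun s => F (z (t + s)) (deriv z (t + s))) volume a b := fun t =>
    intervalIntegrable_of_norm_le (hmeas.comp (measurable_const_add t)).aestronglyMeasurable
      fun s => hFz _ _
  rw [← integral_average_translate_eq hGper hmeas (fun t => hFz _ t) hh]
  have hcontL : Continuous fun t => F (w t) (h⁻¹ • (z (t + h) - z t)) :=
    hcont.comp (hw.prodMk (((hz.continuous.comp (continuous_add_const h)).sub
      hz.continuous).const_smul h⁻¹))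
  have hprim : Continuous fun t => ∫ s in (0 : ℝ)..h, F (z (t + s)) (deriv z (t + s)) := by
    have h1 : ∀ t, ∫ s in (0 : ℝ)..h, F (z (t + s)) (deriv z (t + s)) =
        (∫ s in (0 : ℝ)..(t + h), F (z s) (deriv z s)) -
          ∫ s in (0 : ℝ)..t, F (z s) (deriv z s) := fun t => by
      rw [intervalIntegral.integral_interval_sub_left (by simpa using hint 0 _ _)
        (by simpa using hint 0 _ _),
        intervalIntegral.integral_comp_add_left (fun s => F (z s) (deriv z s)), add_zero]
    simp only [h1]
    have h2 := intervalIntegral.continuous_primitive (μ := volume)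
      (f := fun s => F (z s) (deriv z s)) (fun a b => by simpa using hint 0 a b) 0
    exact (h2.comp (continuous_add_const h)).sub h2
  -- The difference quotient is the mean of `deriv z` over `[t, t + h]`: Jensen applies with
  -- position frozen at `w t`, and `hε` then exchanges `w t` for `z (t + s)`.
  have hle : ∀ t ∈ Icc (0 : ℝ) 1, F (w t) (h⁻¹ • (z (t + h) - z t)) ≤
      (h⁻¹ * ∫ s in (0 : ℝ)..h, F (z (t + s)) (deriv z (t + s))) + ε := by
    intro t ht
    have e1 : z (t + h) - z t = ∫ s in (0 : ℝ)..h, deriv z (t + s) := by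
      rw [intervalIntegral.integral_comp_add_left (fun s => deriv z s), hz.isPrimitive.integral_eq,
        add_zero]
    have i1 : IntervalIntegrable (fun s => deriv z (t + s)) volume 0 h :=
      intervalIntegrable_of_norm_le ((measurable_deriv z).comp
        (measurable_const_add t)).aestronglyMeasurable (fun s => hzd _) 0 h
    have i2 : IntervalIntegrable (fun s => F (w t) (deriv z (t + s))) volume 0 h :=
      intervalIntegrable_of_norm_le ((measurable_integrand hcont measurable_const
        (measurable_deriv z)).comp (measurable_const_add t)).aestronglyMeasurable
        (fun s => hFz _ _) 0 h
    have hFc : Continuous (F (w t)) := hcont.comp (Continuous.prodMk_right (w t))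
    rw [e1]
    refine ((hconv (w t)).map_interval_average_le hFc hh i1 i2).trans ?_
    have e2 : h⁻¹ * (∫ s in (0 : ℝ)..h, (F (z (t + s)) (deriv z (t + s)) + ε)) =
        (h⁻¹ * ∫ s in (0 : ℝ)..h, F (z (t + s)) (deriv z (t + s))) + ε := by
      rw [intervalIntegral.integral_add (hint t 0 h) (by simp)]
      simp only [intervalIntegral.integral_const, sub_zero, smul_eq_mul]
      rw [mul_add, inv_mul_cancel_left₀ hh.ne']
    rw [← e2]
    refine mul_le_mul_of_nonneg_left ?_ (inv_pos.mpr hh).le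
    exact intervalIntegral.integral_mono_on hh.le i2 ((hint t 0 h).add (by simp))
      fun s hs => hε t ht s hs _ (hzd _)
  have hprim' := (hprim.const_smul h⁻¹).intervalIntegrable (μ := volume) 0 1
  refine (intervalIntegral.integral_mono_on zero_le_one (hcontL.intervalIntegrable 0 1)
    (hprim'.add (by simp)) hle).trans_eq ?_
  rw [intervalIntegral.integral_add hprim' (by simp)]
  simp

/-- Lower semicontinuity of the variational integral along uniformly convergent sequences of
equi-Lipschitz loops. -/
theorem integral_le_of_tendstoUniformly (hcont : Continuous fun x : Plane × Plane => F x.1 x.2)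
    (hconv : ∀ p, ConvexOn ℝ univ (F p)) {m : ℝ} (hm : 0 ≤ m)
    (hF : ∀ p q : Plane, ‖F p q‖ ≤ m * ‖q‖) {K : NNReal} {w : ℕ → ℝ → Plane} {w₀ : ℝ → Plane}
    (hw : ∀ n, LipschitzWith K (w n)) (hwp : ∀ n, Function.Periodic (w n) 1)
    (hw₀ : LipschitzWith K w₀) (hlim : TendstoUniformly w w₀ atTop) {c : ℝ}
    (hc : Tendsto (fun n => ∫ t in (0 : ℝ)..1, F (w n t) (deriv (w n) t)) atTop (𝓝 c)) :
    ∫ t in (0 : ℝ)..1, F (w₀ t) (deriv w₀ t) ≤ c := by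
  have hquot : ∀ z : ℝ → Plane, LipschitzWith K z → ∀ h : ℝ, 0 < h → ∀ t,
      ‖h⁻¹ • (z (t + h) - z t)‖ ≤ K := fun z hz h hh t => by
    rw [norm_smul, norm_inv, Real.norm_of_nonneg hh.le, inv_mul_le_iff₀ hh, mul_comm h]
    simpa [dist_eq_norm, abs_of_pos hh] using hz.dist_le_mul (t + h) t
  have hbd : ∀ z : ℝ → Plane, LipschitzWith K z → ∀ h : ℝ, 0 < h → ∀ t,
      ‖F (w₀ t) (h⁻¹ • (z (t + h) - z t))‖ ≤ m * K := fun z hz h hh t =>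
    (hF _ _).trans (mul_le_mul_of_nonneg_left (hquot z hz h hh t) hm)
  have hcontq : ∀ z : ℝ → Plane, LipschitzWith K z → ∀ h : ℝ,
      Continuous fun t => F (w₀ t) (h⁻¹ • (z (t + h) - z t)) := fun z hz h =>
    hcont.comp (hw₀.continuous.prodMk (((hz.continuous.comp (continuous_add_const h)).sub
      hz.continuous).const_smul h⁻¹))
  refine le_of_forall_pos_le_add fun ε hε => ?_
  obtain ⟨R, hR⟩ := (isCompact_Icc (a := (0 : ℝ)) (b := 1)).exists_bound_of_continuousOn
    hw₀.continuous.continuousOn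
  have huc := ((isCompact_closedBall (0 : Plane) (R + 1)).prod
    (isCompact_closedBall (0 : Plane) K)).uniformContinuousOn_of_continuous hcont.continuousOn
  rw [Metric.uniformContinuousOn_iff] at huc
  obtain ⟨δ, hδ, huc⟩ := huc ε hε
  -- `δ` serves uniform continuity; the cap `1` keeps the approximating curves in the ball of radius
  -- `R + 1`.
  set η := min δ 1 with hη
  have hη0 : 0 < η := lt_min hδ one_pos
  -- Let `n` tend to infinity at fixed `h`. Half of `η` pays for the shift by `s ≤ h`, half for the
  -- distance from `w n` to `w₀`.
  have hstep : ∀ h : ℝ, 0 < h → K * h ≤ η / 2 →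
      ∫ t in (0 : ℝ)..1, F (w₀ t) (h⁻¹ • (w₀ (t + h) - w₀ t)) ≤ c + ε := by
    intro h hh hKh
    have hlim1 : Tendsto (fun n => ∫ t in (0 : ℝ)..1, F (w₀ t) (h⁻¹ • (w n (t + h) - w n t))) atTop
        (𝓝 (∫ t in (0 : ℝ)..1, F (w₀ t) (h⁻¹ • (w₀ (t + h) - w₀ t)))) := by
      refine intervalIntegral.tendsto_integral_filter_of_dominated_convergence (fun _ => m * K)
        (Eventually.of_forall fun n => (hcontq _ (hw n) h).aestronglyMeasurable)
        (Eventually.of_forall fun n => Eventually.of_forall fun t _ => hbd _ (hw n) h hh t)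
        (by simp) (Eventually.of_forall fun t _ => ?_)
      have hFc : Continuous (F (w₀ t)) := hcont.comp (Continuous.prodMk_right (w₀ t))
      exact (hFc.tendsto _).comp
        (((hlim.tendsto_at (t + h)).sub (hlim.tendsto_at t)).const_smul h⁻¹)
    refine le_of_tendsto_of_tendsto hlim1 (hc.add_const ε) ?_
    filter_upwards [Metric.tendstoUniformly_iff.mp hlim (η / 2) (half_pos hη0)] with n hn
    refine integral_difference_quotient_le hcont hconv hm hF hw₀.continuous (hw n) (hwp n) hh ?_
    intro t ht s hs q hq
    have hd : dist (w₀ t) (w n (t + s)) < η := by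
      have h1 : dist (w₀ t) (w₀ (t + s)) ≤ η / 2 := by
        refine (hw₀.dist_le_mul _ _).trans (le_trans ?_ hKh)
        refine mul_le_mul_of_nonneg_left ?_ K.coe_nonneg
        simpa [Real.dist_eq, abs_of_nonneg hs.1] using hs.2
      linarith [dist_triangle (w₀ t) (w₀ (t + s)) (w n (t + s)), hn (t + s)]
    have hwR : ‖w₀ t‖ ≤ R := hR t ht
    have hwR' : ‖w n (t + s)‖ ≤ R + 1 := by
      have h2 : ‖w n (t + s) - w₀ t‖ < 1 := by
        rw [← dist_eq_norm, dist_comm]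
        exact hd.trans_le (min_le_right _ _)
      have h3 := norm_add_le (w n (t + s) - w₀ t) (w₀ t)
      rw [sub_add_cancel] at h3
      linarith
    have h4 := huc (w₀ t, q) ⟨by simpa using hwR.trans (by linarith), by simpa using hq⟩
      (w n (t + s), q) ⟨by simpa using hwR', by simpa using hq⟩
      (by simpa [Prod.dist_eq, hδ] using hd.trans_le (min_le_left _ _))
    rw [Real.dist_eq] at h4
    linarith [(abs_lt.mp h4).2]
  have hh0 : Tendsto (fun k : ℕ => 1 / ((k : ℝ) + 1)) atTop (𝓝 0) :=
    tendsto_one_div_add_atTop_nhds_zero_nat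
  have hpos : ∀ k : ℕ, 0 < 1 / ((k : ℝ) + 1) := fun k => by positivity
  -- Now the step tends to zero: the quotients of `w₀` converge almost everywhere by Rademacher's
  -- theorem, with dominating constant `m * K`.
  have hlim2 : Tendsto (fun k : ℕ => ∫ t in (0 : ℝ)..1,
      F (w₀ t) ((1 / ((k : ℝ) + 1))⁻¹ • (w₀ (t + 1 / ((k : ℝ) + 1)) - w₀ t))) atTop
      (𝓝 (∫ t in (0 : ℝ)..1, F (w₀ t) (deriv w₀ t))) := by
    refine intervalIntegral.tendsto_integral_filter_of_dominated_convergence (fun _ => m * K)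
      (Eventually.of_forall fun k => (hcontq _ hw₀ _).aestronglyMeasurable)
      (Eventually.of_forall fun k => Eventually.of_forall fun t _ => hbd _ hw₀ _ (hpos k) t)
      (by simp) ?_
    filter_upwards [hw₀.ae_differentiableAt_real] with t ht _
    have hFc : Continuous (F (w₀ t)) := hcont.comp (Continuous.prodMk_right (w₀ t))
    refine (hFc.tendsto _).comp ((hasDerivAt_iff_tendsto_slope_zero.mp ht.hasDerivAt).comp
      (tendsto_nhdsWithin_iff.mpr ⟨hh0, Eventually.of_forall fun k => (hpos k).ne'⟩))
  refine le_of_tendsto hlim2 ?_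
  have hsmall : Tendsto (fun k : ℕ => K * (1 / ((k : ℝ) + 1))) atTop (𝓝 0) := by
    simpa using hh0.const_mul (K : ℝ)
  filter_upwards [hsmall.eventually_le_const (half_pos hη0)] with k hk
  exact hstep _ (hpos k) hk

end LowerSemicontinuity

/-- **Arzelà–Ascoli** for equi-Lipschitz sequences of loops. -/
theorem exists_subseq_tendstoUniformly {K : NNReal} {w : ℕ → ℝ → Plane}
    (hw : ∀ n, LipschitzWith K (w n)) (hwp : ∀ n, Function.Periodic (w n) 1) {R : ℝ}
    (hR : ∀ n, ‖w n 0‖ ≤ R) :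
    ∃ (w₀ : ℝ → Plane) (φ : ℕ → ℕ), StrictMono φ ∧ LipschitzWith K w₀ ∧
      Function.Periodic w₀ 1 ∧ TendstoUniformly (fun n => w (φ n)) w₀ atTop := by
  let f : ℕ → BoundedContinuousFunction (Icc (0 : ℝ) 1) Plane := fun n =>
    BoundedContinuousFunction.mkOfCompact ⟨fun x => w n x,
      (hw n).continuous.comp continuous_subtype_val⟩
  have hcomp : IsCompact (closure (range f)) := by
    refine BoundedContinuousFunction.arzela_ascoli (Metric.closedBall 0 (R + K))
      (isCompact_closedBall _ _) _ ?_ ?_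
    · rintro _ x ⟨n, rfl⟩
      have h1 := (hw n).dist_le_mul x 0
      have h2 : ‖w n x - w n 0‖ ≤ K := by
        rw [← dist_eq_norm]
        refine h1.trans (mul_le_of_le_one_right K.coe_nonneg ?_)
        simpa [abs_of_nonneg x.2.1] using x.2.2
      have h3 := norm_add_le (w n x - w n 0) (w n 0)
      rw [sub_add_cancel] at h3
      have h4 : f n x = w n x := rfl
      rw [mem_closedBall_zero_iff, h4]
      linarith [hR n]
    · refine LipschitzWith.uniformEquicontinuous _ K ?_ |>.equicontinuous
      rintro ⟨_, n, rfl⟩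
      exact LipschitzWith.of_dist_le_mul fun x y => (hw n).dist_le_mul x y
  obtain ⟨g, -, φ, hφ, hg⟩ := hcomp.tendsto_subseq fun n => subset_closure (mem_range_self n)
  -- Periodicity carries uniform convergence from the unit interval to the whole line.
  have hfr : ∀ t : ℝ, Int.fract t ∈ Icc (0 : ℝ) 1 := fun t =>
    ⟨Int.fract_nonneg t, (Int.fract_lt_one t).le⟩
  have hwf : ∀ n t, w n t = f n ⟨Int.fract t, hfr t⟩ := fun n t => by
    have h1 := (hwp n).sub_int_mul_eq (x := t) ⌊t⌋
    rw [mul_one] at h1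
    exact h1.symm
  have hu : TendstoUniformly (fun n => w (φ n)) (fun t => g ⟨Int.fract t, hfr t⟩) atTop := by
    rw [Metric.tendstoUniformly_iff]
    intro ε hε
    have h1 := BoundedContinuousFunction.tendsto_iff_tendstoUniformly.mp hg
    filter_upwards [Metric.tendstoUniformly_iff.mp h1 ε hε] with n hn t
    rw [hwf]
    exact hn _
  refine ⟨_, φ, hφ, ?_, fun t => ?_, hu⟩
  · refine LipschitzWith.of_dist_le_mul fun x y => ?_
    exact le_of_tendsto ((hu.tendsto_at x).dist (hu.tendsto_at y))
      (Eventually.of_forall fun n => (hw (φ n)).dist_le_mul x y)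
  · simp only [Int.fract_add_one]

/-! ### The signed area -/

theorem inner_rotI (p q : Plane) : inner ℝ p (rotI q) = p 1 * q 0 - p 0 * q 1 := by
  simp [rotI, PiLp.inner_apply, Fin.sum_univ_two]
  ring

theorem norm_rotI (q : Plane) : ‖rotI q‖ = ‖q‖ := by
  simp [rotI, EuclideanSpace.norm_eq, Fin.sum_univ_two, add_comm]

theorem intervalIntegrable_inner_rotI {u v v' : ℝ → Plane} (hu : Continuous u)
    (h : IsPrimitive v v') (a b : ℝ) :
    IntervalIntegrable (fun t => inner ℝ (u t) (rotI (v' t))) volume a b := by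
  simp only [inner_rotI]
  have hc : ∀ i, Continuous fun t => u t i := fun i =>
    (EuclideanSpace.proj (𝕜 := ℝ) i : Plane →L[ℝ] ℝ).continuous.comp hu
  exact (((h.plane_proj 0).intervalIntegrable a b).continuousOn_mul (hc 1).continuousOn).sub
    (((h.plane_proj 1).intervalIntegrable a b).continuousOn_mul (hc 0).continuousOn)

/-- The bilinear form polarising the signed area is symmetric. -/
theorem integral_inner_rotI_comm {u u' v v' : ℝ → Plane} (hu : IsPrimitive u u')
    (hv : IsPrimitive v v') (hup : Function.Periodic u 1) (hvp : Function.Periodic v 1) :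
    ∫ t in (0 : ℝ)..1, inner ℝ (u t) (rotI (v' t)) =
      ∫ t in (0 : ℝ)..1, inner ℝ (v t) (rotI (u' t)) := by
  -- The two integrands differ by the derivative of `u 1 * v 0 - u 0 * v 1` (in components), which
  -- is periodic.
  have h1 := (hu.plane_proj 1).mul (hv.plane_proj 0)
  have h2 := (hu.plane_proj 0).mul (hv.plane_proj 1)
  have e1 := h1.integral_eq 0 1
  have e2 := h2.integral_eq 0 1
  have hu1 : u 1 = u 0 := by simpa using hup 0
  have hv1 : v 1 = v 0 := by simpa using hvp 0
  rw [hu1, hv1, sub_self] at e1 e2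
  rw [← sub_eq_zero, ← intervalIntegral.integral_sub
    (intervalIntegrable_inner_rotI hu.continuous hv 0 1)
    (intervalIntegrable_inner_rotI hv.continuous hu 0 1)]
  have e3 := intervalIntegral.integral_sub (h1.intervalIntegrable 0 1) (h2.intervalIntegrable 0 1)
  rw [e1, e2, sub_zero] at e3
  rw [← e3]
  simp only [inner_rotI]
  congr 1
  funext t
  ring

/-- The signed area is continuous along uniformly convergent sequences of equi-Lipschitz loops. -/
theorem tendsto_integral_inner_rotI {K : NNReal} {w : ℕ → ℝ → Plane} {w₀ : ℝ → Plane}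
    (hw : ∀ n, LipschitzWith K (w n)) (hwp : ∀ n, Function.Periodic (w n) 1)
    (hw₀ : LipschitzWith K w₀) (hw₀p : Function.Periodic w₀ 1)
    (hlim : TendstoUniformly w w₀ atTop) :
    Tendsto (fun n => ∫ t in (0 : ℝ)..1, inner ℝ (w n t) (rotI (deriv (w n) t))) atTop
      (𝓝 (∫ t in (0 : ℝ)..1, inner ℝ (w₀ t) (rotI (deriv w₀ t)))) := by
  have hest : ∀ n (z : ℝ → Plane) (η : ℝ), LipschitzWith K z → 0 < η →
      (∀ t, dist (w₀ t) (w n t) < η) →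
      ‖∫ t in (0 : ℝ)..1, inner ℝ (w n t - w₀ t) (rotI (deriv z t))‖ ≤ η * K := by
    intro n z η hz hη hn
    have := intervalIntegral.norm_integral_le_of_norm_le_const (a := 0) (b := 1) (C := η * K)
      (f := fun t => inner ℝ (w n t - w₀ t) (rotI (deriv z t))) fun t _ => by
        refine (norm_inner_le_norm _ _).trans ?_
        rw [norm_rotI]
        refine mul_le_mul ?_ (norm_deriv_le_of_lipschitz hz) (norm_nonneg _) hη.le
        rw [← dist_eq_norm, dist_comm]
        exact (hn t).le
    simpa using this
  rw [Metric.tendsto_atTop']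
  intro ε hε
  have hη : 0 < ε / (2 * K + 1) := by positivity
  obtain ⟨N, hN⟩ := eventually_atTop.mp (Metric.tendstoUniformly_iff.mp hlim _ hη)
  refine ⟨N, fun n hn => ?_⟩
  have h1 := hest n (w n) _ (hw n) hη (hN n hn.le)
  have h2 := hest n w₀ _ hw₀ hη (hN n hn.le)
  have hsymm := integral_inner_rotI_comm hw₀.isPrimitive (hw n).isPrimitive hw₀p (hwp n)
  -- With `B` the symmetric polarisation, `B(w,w) - B(w₀,w₀) = B(w-w₀,w) + B(w-w₀,w₀)` after moving
  -- the derivative off the difference. Each term is at most `K` times the uniform distance, whence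
  -- the denominator `2 * K + 1`.
  have e : (∫ t in (0 : ℝ)..1, inner ℝ (w n t) (rotI (deriv (w n) t))) -
      ∫ t in (0 : ℝ)..1, inner ℝ (w₀ t) (rotI (deriv w₀ t)) =
      (∫ t in (0 : ℝ)..1, inner ℝ (w n t - w₀ t) (rotI (deriv (w n) t))) +
        ∫ t in (0 : ℝ)..1, inner ℝ (w n t - w₀ t) (rotI (deriv w₀ t)) := by
    simp only [inner_sub_left]
    rw [intervalIntegral.integral_sub, intervalIntegral.integral_sub, hsymm]
    · ring
    · exact intervalIntegrable_inner_rotI (hw n).continuous hw₀.isPrimitive 0 1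
    · exact intervalIntegrable_inner_rotI hw₀.continuous hw₀.isPrimitive 0 1
    · exact intervalIntegrable_inner_rotI (hw n).continuous (hw n).isPrimitive 0 1
    · exact intervalIntegrable_inner_rotI hw₀.continuous (hw n).isPrimitive 0 1
  rw [dist_eq_norm, e]
  refine (norm_add_le _ _).trans_lt ?_
  have h3 : ε / (2 * K + 1) * K + ε / (2 * K + 1) * K < ε := by
    have : ε / (2 * K + 1) * (2 * K + 1) = ε := div_mul_cancel₀ _ (by positivity)
    nlinarith
  linarith

theorem integral_congr_representative {Φ : Plane → Plane → ℝ} {u U v V : ℝ → Plane}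
    (hu : u =ᵐ[volume] U) (hv : v =ᵐ[volume] V) :
    ∫ t in (0 : ℝ)..1, Φ (u t) (v t) = ∫ t in (0 : ℝ)..1, Φ (U t) (V t) :=
  intervalIntegral.integral_congr_ae (by filter_upwards [hu, hv] with t h1 h2 _; rw [h1, h2])

theorem IsPrimitive.genLength_eq {F : Plane → Plane → ℝ} {u v : ℝ → Plane} (h : IsPrimitive u v) :
    genLength F u = ∫ t in (0 : ℝ)..1, F (u t) (v t) :=
  integral_congr_representative (ae_eq_refl u) h.weakDeriv_ae_eq

theorem IsPrimitive.signedArea_eq {u v : ℝ → Plane} (h : IsPrimitive u v) :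
    signedArea u = (1 / 2) * ∫ t in (0 : ℝ)..1, inner ℝ (u t) (rotI (v t)) :=
  congrArg (fun x : ℝ => (1 / 2) * x) (integral_congr_representative
    (Φ := fun p q => inner ℝ p (rotI q)) (ae_eq_refl u) h.weakDeriv_ae_eq)

/-- Ellipses realise every signed area. -/
theorem areaClass_nonempty (τ : ℝ) : (areaClass τ).Nonempty := by
  have h : ∀ a b : ℝ, IsPrimitive
      (fun t => (!₂[a * Real.cos (2 * Real.pi * t), b * Real.sin (2 * Real.pi * t)] : Plane))
      (fun t => !₂[a * (-Real.sin (2 * Real.pi * t) * (2 * Real.pi)),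
        b * (Real.cos (2 * Real.pi * t) * (2 * Real.pi))]) := fun a b => by
    have hlin : ∀ t : ℝ, HasDerivAt (fun t => 2 * Real.pi * t) (2 * Real.pi) t := fun t => by
      simpa using (hasDerivAt_id t).const_mul (2 * Real.pi)
    refine isPrimitive_plane fun i => ?_
    fin_cases i
    · change IsPrimitive (fun t : ℝ => a * Real.cos (2 * Real.pi * t))
        (fun t => a * (-Real.sin (2 * Real.pi * t) * (2 * Real.pi)))
      refine ⟨Continuous.locallyIntegrable (by fun_prop), fun x y => ?_⟩
      exact intervalIntegral.integral_eq_sub_of_hasDerivAt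
        (fun t _ => ((hlin t).cos.const_mul a)) (Continuous.intervalIntegrable (by fun_prop) _ _)
    · change IsPrimitive (fun t : ℝ => b * Real.sin (2 * Real.pi * t))
        (fun t => b * (Real.cos (2 * Real.pi * t) * (2 * Real.pi)))
      refine ⟨Continuous.locallyIntegrable (by fun_prop), fun x y => ?_⟩
      exact intervalIntegral.integral_eq_sub_of_hasDerivAt
        (fun t _ => ((hlin t).sin.const_mul b)) (Continuous.intervalIntegrable (by fun_prop) _ _)
  -- The ellipse with coefficients `a`, `b` has signed area `-π * a * b`, as counterclockwise loops
  -- count negatively.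
  refine ⟨_, (h 1 (-τ / Real.pi)).mem_W11Loops fun t => ?_, ?_⟩
  · simp only [mul_add, mul_one, Real.cos_add_two_pi, Real.sin_add_two_pi]
  · rw [(h 1 (-τ / Real.pi)).signedArea_eq]
    have e : ∀ t : ℝ, inner ℝ (!₂[1 * Real.cos (2 * Real.pi * t),
        -τ / Real.pi * Real.sin (2 * Real.pi * t)] : Plane)
        (rotI !₂[1 * (-Real.sin (2 * Real.pi * t) * (2 * Real.pi)),
          -τ / Real.pi * (Real.cos (2 * Real.pi * t) * (2 * Real.pi))]) = 2 * τ := fun t => by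
      rw [inner_rotI]
      have hpi := Real.pi_ne_zero
      have hsc := Real.sin_sq_add_cos_sq (2 * Real.pi * t)
      generalize 2 * Real.pi * t = θ at hsc ⊢
      simp only [Matrix.cons_val_zero, Matrix.cons_val_one]
      field_simp
      linear_combination τ * hsc
    simp only [e]
    simp

/-! ### Normalised loops and the direct method -/

section Reduction

variable {F : Plane → Plane → ℝ}

/-- Every loop can be replaced by a Lipschitz loop starting in the unit cell, with the same length
and area, and a Lipschitz constant controlled by the length. -/
theorem exists_lipschitzWith_loop (hcont : Continuous fun x : Plane × Plane => F x.1 x.2)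
    (hhom : ∀ (p q : Plane) (l : ℝ), 0 < l → F p (l • q) = l * F p q) {m₁ m₂ : ℝ} (hm₁ : 0 < m₁)
    (hell : ∀ p q : Plane, m₁ * ‖q‖ ≤ F p q ∧ F p q ≤ m₂ * ‖q‖)
    (hper : ∀ (p q : Plane) (a b : ℤ), F (p + !₂[(a : ℝ), (b : ℝ)]) q = F p q)
    {u : ℝ → Plane} (hu : u ∈ W11Loops) :
    ∃ w : ℝ → Plane, LipschitzWith (genLength F u / m₁ + 1).toNNReal w ∧
      Function.Periodic w 1 ∧ ‖w 0‖ ≤ 2 ∧ genLength F w = genLength F u ∧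
      signedArea w = signedArea u := by
  obtain ⟨U, hU, hp, hUp, hd⟩ := exists_periodic_isPrimitive hu
  obtain ⟨w, hw, hwp, hΦ⟩ := exists_lipschitzWith_reparam hp hUp hUp.deriv
  have hlen : genLength F u = ∫ t in (0 : ℝ)..1, F (U t) (deriv U t) :=
    integral_congr_representative hU hd
  have harea : signedArea u = (1 / 2) * ∫ t in (0 : ℝ)..1, inner ℝ (U t) (rotI (deriv U t)) :=
    congrArg (fun x : ℝ => (1 / 2) * x)
      (integral_congr_representative (Φ := fun p q => inner ℝ p (rotI q)) hU hd)
  have hnorm : IntervalIntegrable (fun t => ‖deriv U t‖) volume 0 1 :=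
    (hp.intervalIntegrable 0 1).norm
  have hK : (∫ t in (0 : ℝ)..1, ‖deriv U t‖) ≤ genLength F u / m₁ := by
    rw [le_div_iff₀' hm₁, hlen, ← intervalIntegral.integral_const_mul]
    refine intervalIntegral.integral_mono_on zero_le_one (hnorm.const_mul m₁) ?_
      fun t _ => (hell _ _).1
    refine (hnorm.const_mul m₂).mono_fun (measurable_integrand hcont hp.continuous.measurable
      (measurable_deriv U)).aestronglyMeasurable (Eventually.of_forall fun t => ?_)
    have h1 := hell (U t) (deriv U t)
    have h2 : 0 ≤ F (U t) (deriv U t) := (by positivity : (0 : ℝ) ≤ m₁ * ‖deriv U t‖).trans h1.1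
    beta_reduce
    rw [Real.norm_of_nonneg h2]
    exact h1.2.trans (le_abs_self _)
  -- This integer translation replaces the coordinates of the starting point by their fractional
  -- parts, without changing `F`.
  set a : ℤ := -⌊w 0 0⌋ with ha
  set b : ℤ := -⌊w 0 1⌋ with hb
  set z : ℝ → Plane := fun t => w t + !₂[(a : ℝ), (b : ℝ)] with hz
  have hzw : ∀ t, deriv z t = deriv w t := fun t => deriv_add_const _
  have hzL : LipschitzWith (genLength F u / m₁ + 1).toNNReal z := by
    have h1 : LipschitzWith (genLength F u / m₁ + 1).toNNReal w :=
      hw.weaken (Real.toNNReal_le_toNNReal (by linarith))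
    refine LipschitzWith.of_dist_le_mul fun x y => ?_
    simpa [hz] using h1.dist_le_mul x y
  have hzp : Function.Periodic z 1 := fun t => by simp only [hz, hwp t]
  refine ⟨z, hzL, hzp, ?_, ?_, ?_⟩
  · have h0 : z 0 0 = Int.fract (w 0 0) := by simp [hz, ha, Int.fract, sub_eq_add_neg]
    have h1 : z 0 1 = Int.fract (w 0 1) := by simp [hz, hb, Int.fract, sub_eq_add_neg]
    rw [EuclideanSpace.norm_eq, Fin.sum_univ_two, h0, h1, Real.sqrt_le_left two_pos.le,
      Real.norm_of_nonneg (Int.fract_nonneg _), Real.norm_of_nonneg (Int.fract_nonneg _)]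
    nlinarith [Int.fract_nonneg (w 0 0), Int.fract_nonneg (w 0 1), Int.fract_lt_one (w 0 0),
      Int.fract_lt_one (w 0 1)]
  · rw [hzL.isPrimitive.genLength_eq, hlen, ← hΦ F hhom]
    simp only [hzw]
    simp only [hz, hper]
  · have hA := hΦ (fun p q => inner ℝ p (rotI q)) fun p q l _ => by
      simp only [inner_rotI, PiLp.smul_apply, smul_eq_mul]
      ring
    -- By symmetry the translation contributes to the area only through the derivative of a
    -- constant.
    have hcst := integral_inner_rotI_comm
      (isPrimitive_of_contDiff (contDiff_const (c := (!₂[(a : ℝ), (b : ℝ)] : Plane))))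
      hw.isPrimitive (fun _ => rfl) hwp
    rw [hzL.isPrimitive.signedArea_eq, harea, ← hA]
    simp only [hzw]
    simp only [hz, inner_add_left]
    rw [intervalIntegral.integral_add
      (intervalIntegrable_inner_rotI hw.continuous hw.isPrimitive 0 1)
      (intervalIntegrable_inner_rotI continuous_const hw.isPrimitive 0 1), hcst]
    simp [inner_rotI]

end Reduction

theorem mainTheorem1 (F : Plane → Plane → ℝ)
    (hcont : Continuous fun x : Plane × Plane => F x.1 x.2)
    (hconv : ∀ p, ConvexOn ℝ univ (F p))
    (hhom : ∀ (p q : Plane) (l : ℝ), 0 < l → F p (l • q) = l * F p q)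
    (hell : ∃ m₁ m₂ : ℝ, 0 < m₁ ∧ 0 < m₂ ∧
      ∀ p q : Plane, m₁ * ‖q‖ ≤ F p q ∧ F p q ≤ m₂ * ‖q‖)
    (hper : ∀ (p q : Plane) (a b : ℤ), F (p + !₂[(a : ℝ), (b : ℝ)]) q = F p q)
    (τ : ℝ) :
    ∃ u ∈ areaClass τ, (∃ K : NNReal, LipschitzWith K u) ∧
      genLength F u = isoInf F τ ∧ IsMinOn (genLength F) (areaClass τ) u := by
  obtain ⟨m₁, m₂, hm₁, hm₂, hell⟩ := hell
  have hF0 : ∀ p q, 0 ≤ F p q := fun p q =>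
    (by positivity : (0 : ℝ) ≤ m₁ * ‖q‖).trans (hell p q).1
  have hFn : ∀ p q, ‖F p q‖ ≤ m₂ * ‖q‖ := fun p q => by
    rw [Real.norm_of_nonneg (hF0 p q)]
    exact (hell p q).2
  have hbdd : BddBelow (genLength F '' areaClass τ) := ⟨0, by
    rintro _ ⟨u, -, rfl⟩
    exact intervalIntegral.integral_nonneg zero_le_one fun t _ => hF0 _ _⟩
  obtain ⟨l, hanti, hl, hmem⟩ := exists_seq_tendsto_sInf ((areaClass_nonempty τ).image _) hbdd
  choose u hu hul using hmem
  choose w hwL hwp hw0 hwlen hwarea using fun n =>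
    exists_lipschitzWith_loop hcont hhom hm₁ hell hper (hu n).1
  -- The minimising values decrease, so the first one gives a common Lipschitz constant.
  have hwL' : ∀ n, LipschitzWith (l 0 / m₁ + 1).toNNReal (w n) := fun n => by
    refine (hwL n).weaken (Real.toNNReal_le_toNNReal ?_)
    rw [hul]
    have := hanti n.zero_le
    gcongr
  obtain ⟨w₀, φ, hφ, hw₀L, hw₀p, hlim⟩ := exists_subseq_tendstoUniformly hwL' hwp hw0
  have hlow : genLength F w₀ ≤ isoInf F τ := by
    rw [hw₀L.isPrimitive.genLength_eq]
    refine integral_le_of_tendstoUniformly hcont hconv hm₂.le hFn (fun n => hwL' (φ n))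
      (fun n => hwp (φ n)) hw₀L hlim ?_
    refine (hl.comp hφ.tendsto_atTop).congr fun n => ?_
    rw [← (hwL' (φ n)).isPrimitive.genLength_eq, hwlen, hul]
    rfl
  have hmem₀ : w₀ ∈ areaClass τ := by
    refine ⟨hw₀L.isPrimitive.mem_W11Loops hw₀p, ?_⟩
    have h1 := (tendsto_integral_inner_rotI (fun n => hwL' (φ n)) (fun n => hwp (φ n)) hw₀L hw₀p
      hlim).const_mul (1 / 2 : ℝ)
    simp only [← (hwL' _).isPrimitive.signedArea_eq, ← hw₀L.isPrimitive.signedArea_eq, hwarea,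
      (hu _).2] at h1
    exact tendsto_nhds_unique h1 tendsto_const_nhds
  refine ⟨w₀, hmem₀, ⟨_, hw₀L⟩, le_antisymm hlow (csInf_le hbdd (mem_image_of_mem _ hmem₀)), ?_⟩
  exact fun v hv => hlow.trans (csInf_le hbdd (mem_image_of_mem _ hv))
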